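/- Let $H$ be a separable complex Hilbert space, let $A$ be a (possibly unbounded) self-adjoint operator in $H$ with spectral measure $E$ (a projection-valued measure on the Borel sets of $\mathbb R$), and for $f\in H$ let $\mu_f(\delta)=(E(\delta)f,f)$. Call $f$ of maximal type if $\mu_f\sim E$, i.e. for every Borel set $\delta\subset\mathbb R$ one has $\mu_f(\delta)=0$ if and only if $E(\delta)=0$; let $\Omega_E$ be the set of all vectors of maximal type. Let $L\subset H$ be a closed subspace that is cyclic for $A$, i.e. the closed linear span of $\{E(\delta)f:\ f\in L,\ \delta\subset\mathbb R \text{ Borel}\}$ is $H$. Then: (a) $L\setminus\Omega_E$ is an $F_\sigma$-set of first category in $L$; (b) $\omega(\Omega_E\cap L)=1$ for every nondegenerate Gaussian measure $\omega$ on $L$. Here a Gaussian measure on $L$ is a Borel probability measure for which every continuous real-linear functional on $L$ has a (possibly degenerate) normal distribution on $\mathbb R$; the mean may be nonzero. It is nondegenerate if no nonzero continuous complex-linear functional on $L$ is $\omega$-almost surely constant (equivalently, its covariance operator is injective). -/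

import Mathlib

open MeasureTheory Set

section SpectralTheory

variable {H : Type*} [NormedAddCommGroup H] [InnerProductSpace ℂ H] [CompleteSpace H]

/-- An orthogonal (projection-valued) measure on the Borel sets of the real line: its values are
orthogonal projections, it is countably additive in the strong operator topology, and the whole
line has measure `1`. The corresponding resolution of the identity is `t ↦ E (Iio t)`. -/
structure OrthogonalMeasure (H : Type*) [NormedAddCommGroup H] [InnerProductSpace ℂ H]
    [CompleteSpace H] where
  /-- The projection attached to a set. -/
  proj : Set ℝ → (H →L[ℂ] H)
  isStarProjection : ∀ s, MeasurableSet s → IsStarProjection (proj s)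
  proj_univ : proj univ = 1
  hasSum_proj : ∀ s : ℕ → Set ℝ, (∀ i, MeasurableSet (s i)) →
    Pairwise (Function.onFun Disjoint s) →
      ∀ f : H, HasSum (fun i => proj (s i) f) (proj (⋃ i, s i) f)

namespace OrthogonalMeasure

theorem proj_empty (E : OrthogonalMeasure H) (f : H) : E.proj ∅ f = 0 := by
  have h := E.hasSum_proj (fun _ => ∅) (fun _ => MeasurableSet.empty)
    (fun i j _ => by simp [Function.onFun]) f
  exact (summable_const_iff (E.proj ∅ f)).1 h.summable

theorem inner_proj_nonneg (E : OrthogonalMeasure H) (f : H) {s : Set ℝ} (hs : MeasurableSet s) :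
    0 ≤ (inner ℂ f (E.proj s f)).re := by
  have hp := E.isStarProjection s hs
  have h1 : E.proj s f = E.proj s (E.proj s f) := by
    have := congrArg (fun T : H →L[ℂ] H => T f) hp.isIdempotentElem.eq
    simpa using this.symm
  have h2 : inner ℂ f (E.proj s (E.proj s f)) = inner ℂ (E.proj s f) (E.proj s f) := by
    have hsa := hp.isSelfAdjoint
    rw [← ContinuousLinearMap.adjoint_inner_left, ← ContinuousLinearMap.star_eq_adjoint, hsa.star_eq]
  rw [h1, h2]
  exact inner_self_nonneg (𝕜 := ℂ)

/-- The scalar measure `μ_f(δ) = (E(δ) f, f)` of a vector `f`. -/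
noncomputable def scalarMeasure (E : OrthogonalMeasure H) (f : H) : Measure ℝ :=
  Measure.ofMeasurable (fun s _ => ENNReal.ofReal (inner ℂ f (E.proj s f)).re)
    (by simp [E.proj_empty])
    (by
      intro s hs hd
      have h := ((E.hasSum_proj s hs hd f).mapL (innerSL ℂ f)).mapL Complex.reCLM
      simp only [innerSL_apply_apply, Complex.reCLM_apply] at h
      rw [← h.tsum_eq]
      exact ENNReal.ofReal_tsum_of_nonneg (fun i => E.inner_proj_nonneg f (hs i)) h.summable)

/-- `E` is the spectral measure of the (possibly unbounded) operator `A`, that is,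
`A = ∫ t dE(t)`: the domain of `A` consists of the `f` with `∫ t² dμ_f < ∞`, and
`(A f, f) = ∫ t dμ_f` for these `f`. -/
structure IsSpectralMeasureOf (E : OrthogonalMeasure H) (A : H →ₗ.[ℂ] H) : Prop where
  mem_domain_iff : ∀ f : H, f ∈ A.domain ↔ Integrable (fun t : ℝ => t ^ 2) (E.scalarMeasure f)
  inner_apply : ∀ f : A.domain,
    inner ℂ (f : H) (A f) = ((∫ t : ℝ, t ∂(E.scalarMeasure (f : H)) : ℝ) : ℂ)

/-- The smallest closed subspace containing all `E(δ) f`, `f ∈ L`, `δ` Borel. -/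
noncomputable def generatedSubspace (E : OrthogonalMeasure H) (L : Submodule ℂ H) :
    Submodule ℂ H :=
  (Submodule.span ℂ {x : H | ∃ s : Set ℝ, MeasurableSet s ∧ ∃ f ∈ L, x = E.proj s f}
    ).topologicalClosure

/-- `L` is a cyclic subspace. -/
def IsCyclic (E : OrthogonalMeasure H) (L : Submodule ℂ H) : Prop :=
  E.generatedSubspace L = ⊤

/-- The set of vectors of maximal type: those `f` for which the measures `μ_f` and `E` have the
same null sets. -/
def maximalType (E : OrthogonalMeasure H) : Set H :=
  {f : H | ∀ s : Set ℝ, MeasurableSet s → (E.scalarMeasure f s = 0 ↔ E.proj s = 0)}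

end OrthogonalMeasure

end SpectralTheory

/-- Countable unions of closed sets. -/
def IsFSigma {X : Type*} [TopologicalSpace X] (S : Set X) : Prop :=
  ∃ F : ℕ → Set X, (∀ n, IsClosed (F n)) ∧ S = ⋃ n, F n

/-- A measure on a complex normed space is nondegenerate if no nonzero continuous complex linear
functional is almost surely constant. For a Gaussian measure on a Hilbert space this says that the
covariance operator `x ↦ ∫ ⟪f - m, x⟫ (f - m) dω(f)`, with `m` the mean, is injective. -/
def IsNondegenerateMeasure {X : Type*} [NormedAddCommGroup X] [NormedSpace ℂ X]
    [MeasurableSpace X] (ω : Measure X) : Prop :=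
  ∀ l : StrongDual ℂ X, l ≠ 0 → ¬ ∃ c : ℂ, ∀ᵐ f ∂ω, l f = c

/-! Fix a finite measure `ν` with the null sets of `E`. Each `f` has a largest set `Z_f` (mod `ν`)
with `E(Z_f) f = 0`, and `f` is of maximal type iff `z(f) = ν(Z_f)` vanishes. By Borel–Cantelli `z`
is upper semicontinuous, so the exceptional vectors form the union of the closed sets `z ≥ 1/(n+1)`.

Both halves rest on `tendsto_measure_zeroSet_quadratic`. A set annihilating `p + t q + t² r` at
three values of `t` annihilates `p`, `q` and `r`, so outside the common zero set the `Z` along the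
curve overlap at most twice and their measures tend to `0`.

Category: small multiples of members of a dense sequence, added to `f`, shrink `Z_f` to nearly the
common zero set of that sequence, which is null by cyclicity. Thus `{z < ε}` is dense in `L`.

Gaussian part: for independent `f`, `g` with law `ω` and mean `m`, the vector `m + cos θ (f - m) +
sin θ (g - m)` again has law `ω`. Along suitable angles the limsup of its `z` is at most `ν(Z_f ∩
Z_g)`. Reverse Fatou gives `∫ z ≤ ∫∫ ν(Z_f ∩ Z_g) ≤ ∫ z`, so almost surely `Z_f ⊆ Z_g` mod `ν`, that
is, `E(Z_f) g = 0`. Nondegeneracy and cyclicity then give `E(Z_f) = 0`. -/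

open Filter Topology ProbabilityTheory
open scoped ENNReal

/-! ### Limsup of sets under a finite measure -/

section LimsupMeasure

variable {α : Type*} [MeasurableSpace α] {ν : Measure α} [IsFiniteMeasure ν]

theorem tendsto_measure_iUnion_add_limsup {S : ℕ → Set α} (hS : ∀ n, MeasurableSet (S n)) :
    Tendsto (fun n => ν (⋃ i, S (i + n))) atTop (𝓝 (ν (limsup S atTop))) := by
  have h : limsup S atTop = ⋂ n, ⋃ i, S (i + n) := by
    rw [limsup_eq_iInf_iSup_of_nat']
    simp
  rw [h]
  refine tendsto_measure_iInter_atTop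
    (fun n => (MeasurableSet.iUnion fun i => hS (i + n)).nullMeasurableSet) ?_
    ⟨0, measure_ne_top _ _⟩
  intro m n hmn
  refine iUnion_subset fun i => ?_
  obtain ⟨k, rfl⟩ := Nat.exists_eq_add_of_le hmn
  exact subset_iUnion_of_subset (i + k) (by rw [add_assoc, add_comm k m])

theorem le_measure_limsup {S : ℕ → Set α} (hS : ∀ n, MeasurableSet (S n)) {c : ℝ≥0∞}
    (h : ∀ n, c ≤ ν (S n)) : c ≤ ν (limsup S atTop) :=
  ge_of_tendsto' (tendsto_measure_iUnion_add_limsup hS) fun n =>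
    (h n).trans (measure_mono (subset_iUnion_of_subset 0 (by simp)))

theorem tendsto_measure_zero_of_limsup {S : ℕ → Set α} (hS : ∀ n, MeasurableSet (S n))
    (h : ν (limsup S atTop) = 0) : Tendsto (fun n => ν (S n)) atTop (𝓝 0) := by
  refine tendsto_of_tendsto_of_tendsto_of_le_of_le tendsto_const_nhds
    (h ▸ tendsto_measure_iUnion_add_limsup hS) (fun n => zero_le) fun n => ?_
  exact measure_mono (subset_iUnion_of_subset 0 (by simp))

/-- If triple intersections are null, then the measures of the sets tend to zero. -/
theorem tendsto_measure_zero_of_triple_inter {S : ℕ → Set α} (hS : ∀ n, MeasurableSet (S n))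
    (h : ∀ i j k, i < j → j < k → ν (S i ∩ S j ∩ S k) = 0) :
    Tendsto (fun n => ν (S n)) atTop (𝓝 0) := by
  refine tendsto_measure_zero_of_limsup hS ?_
  refine measure_mono_null (t := ⋃ i, ⋃ j, ⋃ k, ⋃ (_ : i < j), ⋃ (_ : j < k), S i ∩ S j ∩ S k)
    ?_ ?_
  · intro x hx
    have hx : ∃ᶠ n in atTop, x ∈ S n := by
      rwa [← mem_limsup_iff_frequently_mem]
    rw [frequently_atTop] at hx
    obtain ⟨i, -, hi⟩ := hx 0
    obtain ⟨j, hij, hj⟩ := hx (i + 1)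
    obtain ⟨k, hjk, hk⟩ := hx (j + 1)
    simp only [mem_iUnion]
    exact ⟨i, j, k, hij, hjk, ⟨hi, hj⟩, hk⟩
  · simp only [measure_iUnion_null_iff]
    exact h

/-- If `x ↦ m x` is a family of measures with `m x s ≤ (dist x y)²` on the null sets `s` of
`m y`, then the largest `ν`-measure of an `m x`-null set is upper semicontinuous in `x`. -/
theorem isClosed_setOf_exists_null {X : Type*} [PseudoMetricSpace X] {m : X → Measure α}
    (hm : ∀ x y s, MeasurableSet s → m y s = 0 → m x s ≤ ENNReal.ofReal (dist x y ^ 2))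
    (c : ℝ≥0∞) : IsClosed {x | ∃ s, MeasurableSet s ∧ m x s = 0 ∧ c ≤ ν s} := by
  refine isClosed_of_closure_subset fun x hx => ?_
  rw [Metric.mem_closure_iff] at hx
  -- The radii are summable, so Borel–Cantelli makes the limsup of the sets null for `m x`, while
  -- its `ν`-measure stays at least `c`.
  choose y hy hxy using fun n : ℕ => hx ((1 / 2 : ℝ) ^ n) (by positivity)
  choose s hs hs0 hsc using hy
  refine ⟨limsup s atTop, MeasurableSet.measurableSet_limsup hs, ?_, le_measure_limsup hs hsc⟩
  refine measure_limsup_atTop_eq_zero ?_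
  have hle : ∀ n, m x (s n) ≤ ENNReal.ofReal ((1 / 2 : ℝ) ^ n) := by
    intro n
    refine (hm x (y n) (s n) (hs n) (hs0 n)).trans (ENNReal.ofReal_le_ofReal ?_)
    have h1 : (1 / 2 : ℝ) ^ n ≤ 1 := pow_le_one₀ (by norm_num) (by norm_num)
    have h2 := (hxy n).le
    have h3 : 0 ≤ dist x (y n) := dist_nonneg
    nlinarith
  refine ne_top_of_le_ne_top ?_ (ENNReal.tsum_le_tsum hle)
  rw [← ENNReal.ofReal_tsum_of_nonneg (fun n => by positivity) summable_geometric_two]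
  exact ENNReal.ofReal_ne_top

end LimsupMeasure

/-! ### Algebra of spectral projections -/

namespace OrthogonalMeasure

variable {H : Type*} [NormedAddCommGroup H] [InnerProductSpace ℂ H] [CompleteSpace H]
  (E : OrthogonalMeasure H)

theorem proj_proj {s : Set ℝ} (hs : MeasurableSet s) (f : H) :
    E.proj s (E.proj s f) = E.proj s f := by
  simpa using congrArg (fun T : H →L[ℂ] H => T f) (E.isStarProjection s hs).isIdempotentElem.eq

theorem inner_proj_self {s : Set ℝ} (hs : MeasurableSet s) (f : H) :
    (inner ℂ f (E.proj s f)).re = ‖E.proj s f‖ ^ 2 := by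
  have h : inner ℂ f (E.proj s (E.proj s f)) = inner ℂ (E.proj s f) (E.proj s f) := by
    rw [← ContinuousLinearMap.adjoint_inner_left, ← ContinuousLinearMap.star_eq_adjoint,
      (E.isStarProjection s hs).isSelfAdjoint.star_eq]
  rw [E.proj_proj hs] at h
  rw [h]
  exact inner_self_eq_norm_sq (𝕜 := ℂ) _

theorem scalarMeasure_apply {s : Set ℝ} (hs : MeasurableSet s) (f : H) :
    E.scalarMeasure f s = ENNReal.ofReal (‖E.proj s f‖ ^ 2) := by
  rw [scalarMeasure, Measure.ofMeasurable_apply _ hs, E.inner_proj_self hs]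

theorem scalarMeasure_eq_zero_iff {s : Set ℝ} (hs : MeasurableSet s) (f : H) :
    E.scalarMeasure f s = 0 ↔ E.proj s f = 0 := by
  rw [E.scalarMeasure_apply hs, ENNReal.ofReal_eq_zero]
  constructor
  · intro h
    have : ‖E.proj s f‖ = 0 := by nlinarith [norm_nonneg (E.proj s f)]
    simpa using this
  · intro h
    simp [h]

instance isFiniteMeasure_scalarMeasure (f : H) : IsFiniteMeasure (E.scalarMeasure f) where
  measure_univ_lt_top := by
    rw [E.scalarMeasure_apply MeasurableSet.univ]
    exact ENNReal.ofReal_lt_top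

theorem scalarMeasure_univ (f : H) : E.scalarMeasure f univ = ENNReal.ofReal (‖f‖ ^ 2) := by
  rw [E.scalarMeasure_apply MeasurableSet.univ, E.proj_univ]
  simp

theorem norm_proj_le {s : Set ℝ} (hs : MeasurableSet s) (f : H) : ‖E.proj s f‖ ≤ ‖f‖ := by
  have h : E.scalarMeasure f s ≤ E.scalarMeasure f univ := measure_mono (subset_univ s)
  rw [E.scalarMeasure_univ, E.scalarMeasure_apply hs,
    ENNReal.ofReal_le_ofReal_iff (by positivity)] at h
  exact (pow_le_pow_iff_left₀ (norm_nonneg _) (norm_nonneg _) two_ne_zero).1 h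

theorem proj_eq_zero_of_subset {s t : Set ℝ} (hs : MeasurableSet s) (ht : MeasurableSet t)
    (hst : s ⊆ t) {f : H} (hf : E.proj t f = 0) : E.proj s f = 0 :=
  (E.scalarMeasure_eq_zero_iff hs f).1
    (measure_mono_null hst ((E.scalarMeasure_eq_zero_iff ht f).2 hf))

theorem proj_union {s t : Set ℝ} (hs : MeasurableSet s) (ht : MeasurableSet t)
    (hst : Disjoint s t) (f : H) : E.proj (s ∪ t) f = E.proj s f + E.proj t f := by
  let u : ℕ → Set ℝ := fun n => if n = 0 then s else if n = 1 then t else ∅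
  have hu : ⋃ n, u n = s ∪ t := by
    ext x
    simp only [mem_iUnion, mem_union, u]
    constructor
    · rintro ⟨n, hn⟩
      split_ifs at hn <;> simp_all
    · rintro (h | h)
      · exact ⟨0, by simpa using h⟩
      · exact ⟨1, by simpa using h⟩
  have h1 := E.hasSum_proj u
    (fun n => by
      simp only [u]
      split_ifs
      exacts [hs, ht, MeasurableSet.empty])
    (fun i j hij => by
      simp only [u, Function.onFun]
      split_ifs <;> simp_all [disjoint_comm])
    f
  have h2 := hasSum_sum_of_ne_finset_zero (L := .unconditional ℕ)
    (f := fun n => E.proj (u n) f) (s := {0, 1})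
    (fun n hn => by
      have h0 : n ≠ 0 := fun h => hn (by simp [h])
      have h1 : n ≠ 1 := fun h => hn (by simp [h])
      simp [u, h0, h1, E.proj_empty])
  rw [← hu, h1.unique h2]
  simp [u]

/-- The set `t` already carries the whole mass of the scalar measure of `E(t) f`, so nothing is left
for `s`. -/
theorem proj_proj_of_disjoint {s t : Set ℝ} (hs : MeasurableSet s) (ht : MeasurableSet t)
    (hst : Disjoint s t) (f : H) : E.proj s (E.proj t f) = 0 := by
  rw [← E.scalarMeasure_eq_zero_iff hs]
  have h1 := measure_union (μ := E.scalarMeasure (E.proj t f)) hst ht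
  have h2 : E.scalarMeasure (E.proj t f) t = E.scalarMeasure (E.proj t f) univ := by
    rw [E.scalarMeasure_apply ht, E.proj_proj ht, E.scalarMeasure_univ]
  have h3 : E.scalarMeasure (E.proj t f) (s ∪ t) ≤ E.scalarMeasure (E.proj t f) univ :=
    measure_mono (subset_univ _)
  rw [h1, ← h2] at h3
  rw [add_comm] at h3
  by_contra h0
  exact absurd h3 (not_le.2 (ENNReal.lt_add_right (measure_ne_top _ _) h0))

/-- Split `t` along `s`: the part inside `s` annihilates `f`, and the range of the part outside is
killed by `E(s)`. -/
theorem proj_proj_eq_zero {s t : Set ℝ} (hs : MeasurableSet s) (ht : MeasurableSet t)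
    {f : H} (hf : E.proj s f = 0) : E.proj s (E.proj t f) = 0 := by
  have h := E.proj_union (ht.inter hs) (ht.diff hs)
    (disjoint_sdiff_right.mono_left inter_subset_right) f
  rw [inter_union_sdiff] at h
  rw [h, E.proj_eq_zero_of_subset (ht.inter hs) hs inter_subset_right hf, zero_add]
  exact E.proj_proj_of_disjoint hs (ht.diff hs) disjoint_sdiff_right f

theorem IsCyclic.proj_eq_zero {E : OrthogonalMeasure H} {L : Submodule ℂ H} (hL : E.IsCyclic L)
    {s : Set ℝ} (hs : MeasurableSet s) (h : ∀ f ∈ L, E.proj s f = 0) : E.proj s = 0 := by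
  have hle : E.generatedSubspace L ≤ (E.proj s).ker := by
    refine Submodule.topologicalClosure_minimal _ (Submodule.span_le.2 ?_)
      (E.proj s).isClosed_ker
    rintro x ⟨t, ht, f, hf, rfl⟩
    exact E.proj_proj_eq_zero hs ht (h f hf)
  rw [hL] at hle
  ext f
  exact hle (Submodule.mem_top (x := f))

/-! ### Reference measures and zero sets -/

/-- The measure `ν` has the same Borel null sets as `E`. -/
def IsReference (E : OrthogonalMeasure H) (ν : Measure ℝ) : Prop :=
  ∀ s, MeasurableSet s → (ν s = 0 ↔ E.proj s = 0)

theorem IsCyclic.proj_eq_zero_of_denseRange {E : OrthogonalMeasure H} {L : Submodule ℂ H}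
    (hL : E.IsCyclic L) {h : ℕ → L} (hh : DenseRange h) {s : Set ℝ} (hs : MeasurableSet s)
    (h0 : ∀ n, E.proj s (h n : H) = 0) : E.proj s = 0 := by
  refine hL.proj_eq_zero hs fun f hf => ?_
  have : (fun f : L => E.proj s (f : H)) = fun _ => 0 :=
    hh.equalizer ((E.proj s).continuous.comp continuous_subtype_val) continuous_const
      (funext h0)
  exact congrFun this ⟨f, hf⟩

/-- The sum may have infinite mass; `toFinite` replaces it by a finite measure with the same null
sets. -/
theorem IsCyclic.isReference_toFinite {E : OrthogonalMeasure H} {L : Submodule ℂ H}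
    (hL : E.IsCyclic L) {h : ℕ → L} (hh : DenseRange h) :
    E.IsReference (Measure.sum fun n => E.scalarMeasure (h n : H)).toFinite := by
  intro s hs
  have h1 : (Measure.sum fun n => E.scalarMeasure (h n : H)).toFinite s = 0 ↔
      (Measure.sum fun n => E.scalarMeasure (h n : H)) s = 0 :=
    ⟨fun h => absolutelyContinuous_toFinite _ h, fun h => toFinite_absolutelyContinuous _ h⟩
  rw [h1, Measure.sum_apply _ hs, ENNReal.tsum_eq_zero]
  constructor
  · intro h0
    exact hL.proj_eq_zero_of_denseRange hh hs fun n => (E.scalarMeasure_eq_zero_iff hs _).1 (h0 n)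
  · intro h0 n
    rw [E.scalarMeasure_eq_zero_iff hs, h0]
    rfl

/-- The set where the density of the scalar measure of `f` vanishes; up to `ν`-null sets it is
the largest set annihilating `f`. -/
noncomputable def zeroSet (E : OrthogonalMeasure H) (ν : Measure ℝ) (f : H) : Set ℝ :=
  {t | (E.scalarMeasure f).rnDeriv ν t = 0}

theorem measurableSet_zeroSet (ν : Measure ℝ) (f : H) : MeasurableSet (E.zeroSet ν f) :=
  Measure.measurable_rnDeriv _ _ (measurableSet_singleton 0)

variable {E} {ν : Measure ℝ} [IsFiniteMeasure ν]

theorem IsReference.proj_eq_zero_iff (hν : E.IsReference ν) {s : Set ℝ} (hs : MeasurableSet s)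
    (f : H) : E.proj s f = 0 ↔ ν (s \ E.zeroSet ν f) = 0 := by
  have hac : E.scalarMeasure f ≪ ν := by
    refine Measure.AbsolutelyContinuous.mk fun t ht h0 => ?_
    rw [E.scalarMeasure_eq_zero_iff ht, (hν t ht).1 h0]
    rfl
  rw [← E.scalarMeasure_eq_zero_iff hs]
  conv_lhs => rw [← Measure.withDensity_rnDeriv_eq _ _ hac]
  rw [withDensity_apply_eq_zero (Measure.measurable_rnDeriv _ _), inter_comm]
  rfl

theorem IsReference.proj_zeroSet (hν : E.IsReference ν) (f : H) :
    E.proj (E.zeroSet ν f) f = 0 := by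
  rw [hν.proj_eq_zero_iff (E.measurableSet_zeroSet ν f)]
  simp

theorem IsReference.measure_le_zeroSet (hν : E.IsReference ν) {s : Set ℝ} (hs : MeasurableSet s)
    {f : H} (hf : E.proj s f = 0) : ν s ≤ ν (E.zeroSet ν f) := by
  rw [hν.proj_eq_zero_iff hs] at hf
  exact measure_mono_ae (ae_le_set.2 hf)

theorem IsReference.mem_maximalType_iff (hν : E.IsReference ν) (f : H) :
    f ∈ E.maximalType ↔ ν (E.zeroSet ν f) = 0 := by
  constructor
  · intro h
    have hm := E.measurableSet_zeroSet ν f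
    rw [hν _ hm, ← h _ hm, E.scalarMeasure_eq_zero_iff hm]
    exact hν.proj_zeroSet f
  · intro h s hs
    rw [E.scalarMeasure_eq_zero_iff hs, ← hν s hs]
    constructor
    · intro hf
      exact le_antisymm ((hν.measure_le_zeroSet hs hf).trans h.le) zero_le
    · intro h0
      rw [(hν s hs).1 h0]
      rfl

theorem scalarMeasure_le_of_null {f g : H} {s : Set ℝ} (hs : MeasurableSet s)
    (hg : E.scalarMeasure g s = 0) : E.scalarMeasure f s ≤ ENNReal.ofReal (dist f g ^ 2) := by
  rw [E.scalarMeasure_eq_zero_iff hs] at hg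
  rw [E.scalarMeasure_apply hs]
  have h : E.proj s f = E.proj s (f - g) := by rw [map_sub, hg, sub_zero]
  rw [h, dist_eq_norm]
  gcongr
  exact E.norm_proj_le hs _

theorem IsReference.isClosed_le_measure_zeroSet (hν : E.IsReference ν) (c : ℝ≥0∞) :
    IsClosed {f : H | c ≤ ν (E.zeroSet ν f)} := by
  convert isClosed_setOf_exists_null (ν := ν) (m := fun f : H => E.scalarMeasure f)
    (fun f g s hs hg => scalarMeasure_le_of_null hs hg) c using 1
  ext f
  constructor
  · intro h
    exact ⟨_, E.measurableSet_zeroSet ν f, (E.scalarMeasure_eq_zero_iff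
      (E.measurableSet_zeroSet ν f) f).2 (hν.proj_zeroSet f), h⟩
  · rintro ⟨s, hs, h0, hc⟩
    exact hc.trans (hν.measure_le_zeroSet hs ((E.scalarMeasure_eq_zero_iff hs f).1 h0))

/-! ### Zero sets along quadratic curves, and category -/

/-- A quadratic vector polynomial with three distinct zeros vanishes. -/
theorem quadratic_eq_zero {V : Type*} [AddCommGroup V] [Module ℝ V] {p q r : V} {a b c : ℝ}
    (hab : a ≠ b) (hac : a ≠ c) (hbc : b ≠ c) (ha : p + a • q + a ^ 2 • r = 0)
    (hb : p + b • q + b ^ 2 • r = 0) (hc : p + c • q + c ^ 2 • r = 0) :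
    p = 0 ∧ q = 0 ∧ r = 0 := by
  have h1 : q + (a + b) • r = 0 := by
    have : (a - b) • (q + (a + b) • r) = 0 := by
      rw [← sub_self (0 : V)]
      nth_rewrite 1 [← ha]
      rw [← hb]
      module
    exact (smul_eq_zero.1 this).resolve_left (sub_ne_zero.2 hab)
  have h2 : q + (a + c) • r = 0 := by
    have : (a - c) • (q + (a + c) • r) = 0 := by
      rw [← sub_self (0 : V)]
      nth_rewrite 1 [← ha]
      rw [← hc]
      module
    exact (smul_eq_zero.1 this).resolve_left (sub_ne_zero.2 hac)
  have hr : r = 0 := by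
    have : (b - c) • r = 0 := by
      rw [← sub_self (0 : V)]
      nth_rewrite 1 [← h1]
      rw [← h2]
      module
    exact (smul_eq_zero.1 this).resolve_left (sub_ne_zero.2 hbc)
  subst hr
  have hq : q = 0 := by simpa using h1
  subst hq
  exact ⟨by simpa using ha, rfl, rfl⟩

/-- The projection of a triple intersection kills the curve at three parameters, hence `p`, `q` and
`r`; so that intersection lies in the common zero set mod `ν`. -/
theorem IsReference.tendsto_measure_zeroSet_quadratic (hν : E.IsReference ν) (p q r : H)
    {t : ℕ → ℝ} (ht : Function.Injective t) :
    Tendsto (fun n => ν (E.zeroSet ν (p + t n • q + t n ^ 2 • r) \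
      (E.zeroSet ν p ∩ E.zeroSet ν q ∩ E.zeroSet ν r))) atTop (𝓝 0) := by
  have hm := E.measurableSet_zeroSet ν
  refine tendsto_measure_zero_of_triple_inter
    (fun n => (hm _).diff (((hm _).inter (hm _)).inter (hm _))) fun i j k hij hjk => ?_
  set Z : ℕ → Set ℝ := fun n => E.zeroSet ν (p + t n • q + t n ^ 2 • r) with hZ
  have hs : MeasurableSet (Z i ∩ Z j ∩ Z k) := ((hm _).inter (hm _)).inter (hm _)
  have key : ∀ n, Z i ∩ Z j ∩ Z k ⊆ Z n → E.proj (Z i ∩ Z j ∩ Z k) p +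
      t n • E.proj (Z i ∩ Z j ∩ Z k) q + t n ^ 2 • E.proj (Z i ∩ Z j ∩ Z k) r = 0 := by
    intro n hn
    have h := E.proj_eq_zero_of_subset hs (hm _) hn (hν.proj_zeroSet _)
    rwa [map_add, map_add, ContinuousLinearMap.map_smul_of_tower,
      ContinuousLinearMap.map_smul_of_tower] at h
  obtain ⟨h1, h2, h3⟩ := quadratic_eq_zero (ht.ne hij.ne) (ht.ne (hij.trans hjk).ne)
    (ht.ne hjk.ne) (key i (inter_subset_left.trans inter_subset_left))
    (key j (inter_subset_left.trans inter_subset_right)) (key k inter_subset_right)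
  rw [hν.proj_eq_zero_iff hs] at h1 h2 h3
  refine measure_mono_null ?_ (measure_union_null (measure_union_null h1 h2) h3)
  rintro x ⟨⟨⟨hi, hi'⟩, hj, -⟩, hk, -⟩
  have hx : x ∈ Z i ∩ Z j ∩ Z k := ⟨⟨hi, hj⟩, hk⟩
  by_contra hcon
  simp only [mem_union, Set.mem_sdiff, hx, true_and, not_or, not_not] at hcon
  exact hi' hcon

theorem IsReference.exists_measure_zeroSet_sdiff_le (hν : E.IsReference ν) {L : Submodule ℂ H}
    (h : ℕ → L) {U : Set L} (hU : IsOpen U) (hne : U.Nonempty) (n : ℕ) :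
    ∀ ε : ℝ≥0∞, ε ≠ 0 → ∃ f ∈ U,
      ν (E.zeroSet ν (f : H) \ ⋂ i < n, E.zeroSet ν (h i : H)) ≤ ε := by
  induction n with
  | zero =>
    intro ε _
    obtain ⟨f, hf⟩ := hne
    exact ⟨f, hf, by simp⟩
  | succ n ih =>
    intro ε hε
    obtain ⟨f, hf, hfε⟩ := ih (ε / 2) (ENNReal.half_pos hε).ne'
    have hinj : Function.Injective fun k : ℕ => 1 / ((k : ℝ) + 1) := by
      intro a b hab
      simpa using hab
    -- Perturbing along a line would suffice; `q = r = h n` fits it to the quadratic lemma. The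
    -- parameters tend to `0`, so the perturbed vectors eventually lie in `U`.
    have h1 := hν.tendsto_measure_zeroSet_quadratic (f : H) (h n : H) (h n : H) hinj
    have hcont : Continuous fun t : ℝ => f + t • h n + t ^ 2 • h n := by fun_prop
    have h2 : Tendsto (fun k : ℕ => f + (1 / ((k : ℝ) + 1)) • h n + (1 / ((k : ℝ) + 1)) ^ 2 • h n)
        atTop (𝓝 f) := by
      simpa [Function.comp_def] using (hcont.tendsto 0).comp tendsto_one_div_add_atTop_nhds_zero_nat
    obtain ⟨k, hk1, hk2⟩ := ((h1.eventually_le_const (ENNReal.half_pos hε)).and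
      (h2.eventually (hU.mem_nhds hf))).exists
    refine ⟨_, hk2, ?_⟩
    rw [← ENNReal.add_halves ε]
    refine le_trans (measure_mono ?_) ((measure_union_le _ _).trans (add_le_add hk1 hfε))
    rintro x ⟨hx, hx'⟩
    by_cases hxs : x ∈ E.zeroSet ν (f : H) ∩ E.zeroSet ν (h n : H) ∩ E.zeroSet ν (h n : H)
    · refine Or.inr ⟨hxs.1.1, fun hcon => hx' ?_⟩
      simp only [mem_iInter] at hcon ⊢
      intro i hi
      rcases Nat.lt_succ_iff_lt_or_eq.1 hi with hi | rfl
      · exact hcon i hi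
      · exact hxs.2
    · exact Or.inl ⟨hx, hxs⟩

theorem IsReference.exists_measure_zeroSet_lt (hν : E.IsReference ν) {L : Submodule ℂ H}
    [TopologicalSpace.SeparableSpace L] (hL : E.IsCyclic L) {U : Set L} (hU : IsOpen U)
    (hne : U.Nonempty) {ε : ℝ≥0∞} (hε : ε ≠ 0) :
    ∃ f ∈ U, ν (E.zeroSet ν (f : H)) < ε := by
  set h : ℕ → L := TopologicalSpace.denseSeq L with hh
  set Z : ℕ → Set ℝ := fun i => E.zeroSet ν (h i : H)
  have hm : ∀ i, MeasurableSet (Z i) := fun i => E.measurableSet_zeroSet ν _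
  have hnull : ν (⋂ i, Z i) = 0 := by
    have hmi := MeasurableSet.iInter hm
    rw [hν _ hmi]
    exact hL.proj_eq_zero_of_denseRange (TopologicalSpace.denseRange_denseSeq L) hmi fun n =>
      E.proj_eq_zero_of_subset hmi (hm n) (iInter_subset _ n) (hν.proj_zeroSet _)
  have hlim : Tendsto (fun n => ν (⋂ i < n, Z i)) atTop (𝓝 0) := by
    have h1 : ⋂ n, ⋂ i < n, Z i = ⋂ i, Z i := by
      ext x
      simp only [mem_iInter]
      exact ⟨fun hx i => hx (i + 1) i (Nat.lt_succ_self i), fun hx _ i _ => hx i⟩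
    rw [← hnull, ← h1]
    refine tendsto_measure_iInter_atTop
      (fun n => (MeasurableSet.iInter fun i => MeasurableSet.iInter fun _ =>
        hm i).nullMeasurableSet) ?_ ⟨0, measure_ne_top _ _⟩
    intro m n hmn
    exact biInter_subset_biInter_left fun i hi => lt_of_lt_of_le hi hmn
  -- The preceding lemma gives only `≤`; a `δ` strictly below `ε / 2` restores strictness.
  obtain ⟨δ, hδ0, hδ⟩ := exists_between (ENNReal.half_pos hε)
  obtain ⟨n, hn⟩ := (hlim.eventually_lt_const (ENNReal.half_pos hε)).exists
  obtain ⟨f, hf, hfδ⟩ := hν.exists_measure_zeroSet_sdiff_le h hU hne n δ hδ0.ne'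
  refine ⟨f, hf, ?_⟩
  calc ν (E.zeroSet ν (f : H))
      ≤ ν (E.zeroSet ν (f : H) \ ⋂ i < n, Z i) + ν (⋂ i < n, Z i) := by
        refine le_trans (measure_mono ?_) (measure_union_le _ _)
        rw [sdiff_union_self]
        exact subset_union_left
    _ < ε / 2 + ε / 2 := ENNReal.add_lt_add (hfδ.trans_lt hδ) hn
    _ = ε := ENNReal.add_halves ε

theorem IsReference.compl_maximalType_eq_iUnion (hν : E.IsReference ν) (L : Submodule ℂ H) :
    {f : L | (f : H) ∉ E.maximalType} =
      ⋃ n : ℕ, {f : L | ((n : ℝ≥0∞) + 1)⁻¹ ≤ ν (E.zeroSet ν (f : H))} := by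
  ext f
  simp only [mem_ofPred_eq, mem_iUnion, hν.mem_maximalType_iff]
  constructor
  · intro h
    obtain ⟨n, hn⟩ := ENNReal.exists_inv_nat_lt h
    refine ⟨n, le_trans ?_ hn.le⟩
    exact ENNReal.inv_le_inv.2 le_self_add
  · rintro ⟨n, hn⟩ h0
    rw [h0] at hn
    have := ENNReal.inv_pos.2 (ENNReal.add_ne_top.2 ⟨ENNReal.natCast_ne_top n, ENNReal.one_ne_top⟩)
    exact absurd hn (not_le.2 this)

theorem IsReference.isClosed_le_measure_zeroSet_subtype (hν : E.IsReference ν)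
    (L : Submodule ℂ H) (c : ℝ≥0∞) :
    IsClosed {f : L | c ≤ ν (E.zeroSet ν (f : H))} :=
  (hν.isClosed_le_measure_zeroSet c).preimage continuous_subtype_val

theorem IsReference.isFSigma_compl_maximalType (hν : E.IsReference ν) (L : Submodule ℂ H) :
    IsFSigma {f : L | (f : H) ∉ E.maximalType} :=
  ⟨_, fun _ => hν.isClosed_le_measure_zeroSet_subtype L _, hν.compl_maximalType_eq_iUnion L⟩

theorem IsReference.isMeagre_compl_maximalType (hν : E.IsReference ν) {L : Submodule ℂ H}
    [TopologicalSpace.SeparableSpace L] (hL : E.IsCyclic L) :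
    IsMeagre {f : L | (f : H) ∉ E.maximalType} := by
  rw [hν.compl_maximalType_eq_iUnion L]
  refine isMeagre_iUnion fun n => IsNowhereDense.isMeagre ?_
  rw [(hν.isClosed_le_measure_zeroSet_subtype L _).isNowhereDense_iff]
  by_contra hne
  obtain ⟨f, hf, hlt⟩ := hν.exists_measure_zeroSet_lt hL isOpen_interior
    (nonempty_iff_ne_empty.2 hne) (ε := ((n : ℝ≥0∞) + 1)⁻¹)
    (ENNReal.inv_ne_zero.2 (ENNReal.add_ne_top.2 ⟨ENNReal.natCast_ne_top n, ENNReal.one_ne_top⟩))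
  exact absurd (interior_subset hf) (not_le.2 hlt)

end OrthogonalMeasure

/-! ### Gaussian measures and rotations -/

/-- Rational parametrization of the circle: after multiplication by `1 + t²`, a rotated vector
becomes quadratic in `t`. -/
theorem Real.exists_cos_sin_rational (t : ℝ) :
    ∃ θ : ℝ, Real.cos θ = (1 - t ^ 2) / (1 + t ^ 2) ∧ Real.sin θ = 2 * t / (1 + t ^ 2) := by
  have h0 : (0 : ℝ) < 1 + t ^ 2 := by positivity
  have h1 : √(1 + t ^ 2) ^ 2 = 1 + t ^ 2 := Real.sq_sqrt h0.le
  have h2 : √(1 + t ^ 2) ≠ 0 := (Real.sqrt_pos.2 h0).ne'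
  refine ⟨2 * Real.arctan t, ?_, ?_⟩
  · rw [Real.cos_two_mul, Real.cos_arctan, div_pow, h1]
    field_simp
    ring
  · rw [Real.sin_two_mul, Real.sin_arctan, Real.cos_arctan]
    field_simp
    rw [h1]

/-- A Gaussian measure is the law of `m + cos θ (x - m) + sin θ (y - m)`, where `x` and `y` are
independent with this law and `m` is its mean. -/
theorem ProbabilityTheory.IsGaussian.map_mean_add_rotation {X : Type*} [NormedAddCommGroup X]
    [NormedSpace ℝ X] [CompleteSpace X] [SecondCountableTopology X] [MeasurableSpace X]
    [BorelSpace X] (ω : Measure X) [IsGaussian ω] (θ : ℝ) :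
    (ω.prod ω).map (fun p => ω[id] + Real.cos θ • (p.1 - ω[id]) + Real.sin θ • (p.2 - ω[id])) =
      ω := by
  set m : X := ω[id] with hm
  have hsub : Measurable fun x : X => x - m := measurable_id.sub_const m
  have hadd : Measurable fun x : X => x + m := measurable_id.add_const m
  set ω₀ := ω.map (fun x => x - m) with hω₀
  have : IsProbabilityMeasure ω₀ := Measure.isProbabilityMeasure_map hsub.aemeasurable
  have hint : Integrable id ω := IsGaussian.integrable_id
  have hmean : ω₀[id] = 0 := by
    rw [hω₀, integral_map hsub.aemeasurable aestronglyMeasurable_id]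
    have h : ∫ x, (id x - m) ∂ω = ω[id] - ∫ _, m ∂ω := integral_sub hint (integrable_const m)
    rw [integral_const, probReal_univ, one_smul, ← hm, sub_self] at h
    exact h
  -- Rotation invariance of the product law requires mean zero, hence the centring.
  have hrot := IsGaussian.map_rotation_eq_self hmean θ
  have hback : ω₀.map (fun x => x + m) = ω := by
    rw [hω₀, Measure.map_map hadd hsub]
    simp [Function.comp_def]
  have hfst : ω₀ = (ω₀.prod ω₀).map Prod.fst := by
    rw [Measure.map_fst_prod]
    simp
  have hprod : ω₀.prod ω₀ = (ω.prod ω).map (Prod.map (fun x => x - m) (fun x => x - m)) :=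
    Measure.map_prod_map ω ω hsub hsub
  conv_rhs => rw [← hback, hfst, ← hrot, hprod]
  rw [Measure.map_map (ContinuousLinearMap.continuous _).measurable (hsub.prodMap hsub),
    Measure.map_map measurable_fst
      ((ContinuousLinearMap.continuous _).measurable.comp (hsub.prodMap hsub)),
    Measure.map_map hadd (measurable_fst.comp
      ((ContinuousLinearMap.continuous _).measurable.comp (hsub.prodMap hsub)))]
  congr 1
  ext p
  simp only [Function.comp_apply, ContinuousLinearMap.rotation_apply, Prod.map]
  abel

namespace OrthogonalMeasure

variable {H : Type*} [NormedAddCommGroup H] [InnerProductSpace ℂ H] [CompleteSpace H]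
  {E : OrthogonalMeasure H} {ν : Measure ℝ} [IsFiniteMeasure ν]

theorem IsReference.limsup_measure_zeroSet_le (hν : E.IsReference ν) (m f g : H)
    {t : ℕ → ℝ} (ht : Function.Injective t) :
    limsup (fun n => ν (E.zeroSet ν (m + ((1 - t n ^ 2) / (1 + t n ^ 2)) • (f - m) +
      (2 * t n / (1 + t n ^ 2)) • (g - m)))) atTop ≤ ν (E.zeroSet ν f ∩ E.zeroSet ν g) := by
  -- Coefficients of `1`, `t`, `t²` in `(1 + t²) m + (1 - t²)(f - m) + 2t (g - m)`.
  set p : H := f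
  set q : H := (2 : ℝ) • (g - m) with hq
  set r : H := (2 : ℝ) • m - f with hr
  have hmeas := E.measurableSet_zeroSet ν
  set T : Set ℝ := E.zeroSet ν p ∩ E.zeroSet ν q ∩ E.zeroSet ν r with hT
  have hTm : MeasurableSet T := ((hmeas _).inter (hmeas _)).inter (hmeas _)
  have hTp : E.proj T p = 0 := E.proj_eq_zero_of_subset hTm (hmeas _)
    (inter_subset_left.trans inter_subset_left) (hν.proj_zeroSet _)
  have hTq : E.proj T q = 0 := E.proj_eq_zero_of_subset hTm (hmeas _)
    (inter_subset_left.trans inter_subset_right) (hν.proj_zeroSet _)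
  have hTr : E.proj T r = 0 := E.proj_eq_zero_of_subset hTm (hmeas _)
    inter_subset_right (hν.proj_zeroSet _)
  have hTg : E.proj T g = 0 := by
    have : g = (1 / 2 : ℝ) • (q + r + p) := by
      simp only [hq, hr, p]
      module
    rw [this, ContinuousLinearMap.map_smul_of_tower, map_add, map_add, hTp, hTq, hTr]
    simp
  have hTle : ν T ≤ ν (E.zeroSet ν f ∩ E.zeroSet ν g) := by
    rw [hν.proj_eq_zero_iff hTm] at hTg
    refine measure_mono_ae (ae_le_set.2 (measure_mono_null ?_ hTg))
    rintro x ⟨hx, hx'⟩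
    exact ⟨hx, fun hg => hx' ⟨hx.1.1, hg⟩⟩
  refine le_trans ?_ hTle
  have hlim := (hν.tendsto_measure_zeroSet_quadratic p q r ht).add_const (ν T)
  rw [zero_add] at hlim
  rw [← hlim.limsup_eq]
  refine limsup_le_limsup (Eventually.of_forall fun n => ?_)
  have h0 : (0 : ℝ) < 1 + t n ^ 2 := by positivity
  set F : H := m + ((1 - t n ^ 2) / (1 + t n ^ 2)) • (f - m) +
      (2 * t n / (1 + t n ^ 2)) • (g - m) with hF
  have hu : p + t n • q + t n ^ 2 • r = (1 + t n ^ 2) • F := by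
    have h1 : (1 + t n ^ 2) • ((1 - t n ^ 2) / (1 + t n ^ 2)) • (f - m) =
        (1 - t n ^ 2) • (f - m) := by
      rw [smul_smul]
      congr 1
      field_simp
    have h2 : (1 + t n ^ 2) • (2 * t n / (1 + t n ^ 2)) • (g - m) = (2 * t n) • (g - m) := by
      rw [smul_smul]
      congr 1
      field_simp
    rw [hF, smul_add, smul_add, h1, h2]
    simp only [hq, hr, p]
    module
  have hle : ν (E.zeroSet ν F) ≤ ν (E.zeroSet ν (p + t n • q + t n ^ 2 • r)) := by
    refine hν.measure_le_zeroSet (hmeas _) ?_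
    rw [hu, ContinuousLinearMap.map_smul_of_tower, hν.proj_zeroSet, smul_zero]
  refine hle.trans (le_trans (measure_mono ?_) (measure_union_le _ _))
  rw [sdiff_union_self]
  exact subset_union_left

variable [MeasurableSpace H] [BorelSpace H]

theorem IsReference.measurable_measure_zeroSet (hν : E.IsReference ν) :
    Measurable fun f : H => ν (E.zeroSet ν f) :=
  measurable_of_Ici fun c => (hν.isClosed_le_measure_zeroSet c).measurableSet

/-- The limsup `w` is pointwise at most `z(f)` but has at least its integral, so all inequalities
between them, including that for `ν(Z_f ∩ Z_g)`, are equalities almost everywhere. -/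
theorem IsReference.ae_ae_proj_zeroSet_eq_zero [TopologicalSpace.SeparableSpace H]
    (hν : E.IsReference ν) {L : Submodule ℂ H} [CompleteSpace L] (ω : Measure L) [IsGaussian ω] :
    ∀ᵐ f : L ∂ω, ∀ᵐ g : L ∂ω, E.proj (E.zeroSet ν (f : H)) (g : H) = 0 := by
  have : SecondCountableTopology H := UniformSpace.secondCountable_of_separable H
  set z : L → ℝ≥0∞ := fun f => ν (E.zeroSet ν (f : H)) with hz
  have hzm : Measurable z := hν.measurable_measure_zeroSet.comp measurable_subtype_coe
  set F : ℕ → L × L → L := fun n p => ω[id] +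
    ((1 - (n : ℝ) ^ 2) / (1 + (n : ℝ) ^ 2)) • (p.1 - ω[id]) +
    (2 * (n : ℝ) / (1 + (n : ℝ) ^ 2)) • (p.2 - ω[id]) with hF
  have hFm : ∀ n, Measurable (F n) := fun n => by
    have : Continuous (F n) := by fun_prop
    exact this.measurable
  have hlaw : ∀ n, (ω.prod ω).map (F n) = ω := by
    intro n
    obtain ⟨θ, hc, hs⟩ := Real.exists_cos_sin_rational n
    have := IsGaussian.map_mean_add_rotation ω θ
    rwa [hc, hs] at this
  set w : L × L → ℝ≥0∞ := fun p => limsup (fun n => z (F n p)) atTop with hw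
  have hwm : Measurable w := Measurable.limsup fun n => hzm.comp (hFm n)
  have hwle : ∀ p : L × L, w p ≤ ν (E.zeroSet ν (p.1 : H) ∩ E.zeroSet ν (p.2 : H)) := fun p => by
    have := hν.limsup_measure_zeroSet_le ((ω[id] : L) : H) (p.1 : H) (p.2 : H)
      (t := fun n : ℕ => (n : ℝ)) Nat.cast_injective
    exact this
  have hint : ∫⁻ p, z p.1 ∂(ω.prod ω) = ∫⁻ f, z f ∂ω := by
    conv_rhs => rw [← Measure.fst_prod (μ := ω) (ν := ω), Measure.fst]
    rw [lintegral_map hzm measurable_fst]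
  have hfin : ∀ f, z f ≤ ν univ := fun f => measure_mono (subset_univ _)
  have hintw : ∫⁻ f, z f ∂ω ≤ ∫⁻ p, w p ∂(ω.prod ω) := by
    -- Reverse Fatou, dominated by the constant `ν univ`; every term has integral `∫ z`, since `F n`
    -- has law `ω`.
    have h := limsup_lintegral_le (μ := ω.prod ω) (f := fun n => z ∘ F n) (fun _ => ν univ)
      (fun n => hzm.comp (hFm n)) (fun n => Eventually.of_forall fun p => hfin _)
      (by simp)
    have hc : ∀ n, ∫⁻ p, (z ∘ F n) p ∂(ω.prod ω) = ∫⁻ f, z f ∂ω := fun n => by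
      conv_rhs => rw [← hlaw n, lintegral_map hzm (hFm n)]
      rfl
    simp_rw [hc] at h
    rwa [limsup_const] at h
  have hwz : ∀ p : L × L, w p ≤ z p.1 := fun p => (hwle p).trans (measure_mono inter_subset_left)
  have hae : w =ᵐ[ω.prod ω] fun p => z p.1 := by
    refine ae_eq_of_ae_le_of_lintegral_le (Eventually.of_forall hwz) ?_
      (hzm.comp measurable_fst).aemeasurable (hint.trans_le hintw)
    refine ne_top_of_le_ne_top (b := ∫⁻ _, ν univ ∂(ω.prod ω)) (by simp) ?_
    exact lintegral_mono fun p => (hwz p).trans (hfin _)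
  filter_upwards [Measure.ae_ae_of_ae_prod hae] with f hf
  filter_upwards [hf] with g hg
  have hmeas := E.measurableSet_zeroSet ν
  rw [hν.proj_eq_zero_iff (hmeas _), ← sdiff_self_inter,
    measure_sdiff inter_subset_left ((hmeas _).inter (hmeas _)).nullMeasurableSet
      (measure_ne_top _ _), tsub_eq_zero_iff_le]
  exact hg.symm.le.trans (hwle (f, g))

theorem IsReference.ae_mem_maximalType [TopologicalSpace.SeparableSpace H]
    (hν : E.IsReference ν) {L : Submodule ℂ H} [CompleteSpace L] (hL : E.IsCyclic L)
    (ω : Measure L) [IsGaussian ω] (hω : IsNondegenerateMeasure ω) :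
    ∀ᵐ f : L ∂ω, (f : H) ∈ E.maximalType := by
  filter_upwards [hν.ae_ae_proj_zeroSet_eq_zero ω] with f hf
  have hm := E.measurableSet_zeroSet ν (f : H)
  rw [hν.mem_maximalType_iff, hν _ hm]
  refine hL.proj_eq_zero hm fun g hg => ?_
  set x := E.proj (E.zeroSet ν (f : H)) g
  -- Chosen so that its value at `g` is `⟪x, x⟫`; it vanishes almost surely, so nondegeneracy makes
  -- it zero.
  set l : StrongDual ℂ L :=
    (innerSL ℂ x).comp ((E.proj (E.zeroSet ν (f : H))).comp L.subtypeL) with hl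
  have hl0 : l = 0 := by
    by_contra hne
    refine hω l hne ⟨0, ?_⟩
    filter_upwards [hf] with u hu
    simp [hl, hu]
  have h : inner ℂ x x = 0 := DFunLike.congr_fun hl0 (⟨g, hg⟩ : L)
  exact inner_self_eq_zero.1 h

end OrthogonalMeasure

theorem corollary2 {H : Type*} [NormedAddCommGroup H] [InnerProductSpace ℂ H] [CompleteSpace H]
    [TopologicalSpace.SeparableSpace H] [MeasurableSpace H] [BorelSpace H]
    (A : H →ₗ.[ℂ] H) (hA : IsSelfAdjoint A)
    (E : OrthogonalMeasure H) (hE : E.IsSpectralMeasureOf A)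
    (L : Submodule ℂ H) (hLclosed : IsClosed (L : Set H)) (hL : E.IsCyclic L) :
    (IsFSigma {f : L | (f : H) ∉ E.maximalType} ∧
      IsMeagre {f : L | (f : H) ∉ E.maximalType}) ∧
    ∀ ω : Measure L, ProbabilityTheory.IsGaussian ω → IsNondegenerateMeasure ω →
      ω {f : L | (f : H) ∈ E.maximalType} = 1 := by
  have : SecondCountableTopology H := UniformSpace.secondCountable_of_separable H
  have : CompleteSpace L := hLclosed.completeSpace_coe
  have hν := hL.isReference_toFinite (TopologicalSpace.denseRange_denseSeq L)
  refine ⟨⟨hν.isFSigma_compl_maximalType L, hν.isMeagre_compl_maximalType hL⟩, ?_⟩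
  intro ω _ hω
  rw [measure_congr (eventuallyEq_univ.2 (hν.ae_mem_maximalType hL ω hω)), measure_univ]
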